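/- Let $q\ge 1$. For each $n$ let $(\Omega_n,\mathcal F_n,P_n)$ be a probability space, $m_n$ a nonnegative integer, $\mathcal F_{n,0}\subseteq\mathcal F_{n,1}\subseteq\dots\subseteq\mathcal F_{n,m_n}\subseteq\mathcal F_n$ a filtration, and $\mathbf S_{n,0},\dots,\mathbf S_{n,m_n}$ random vectors in $\mathbb R^q$ such that $\mathbf S_{n,m}$ is $\mathcal F_{n,m}$-measurable and $\mathbf S_{n,0}=0$ almost surely. Write $\Delta\mathbf S_{n,m}=\mathbf S_{n,m}-\mathbf S_{n,m-1}$ for $1\le m\le m_n$, let $\Delta S_{n,m,i}$ be its $i$-th coordinate, and let $\|\cdot\|$ be the maximum norm on $\mathbb R^q$; a maximum or sum over an empty index set is $0$. Let $\Sigma=(\sigma_{ij})$ be a real $q\times q$ matrix. Assume that, as $n\to\infty$, (i) $\sup_n \mathbb E\big[\big(\max_{1\le m\le m_n}\|\Delta\mathbf S_{n,m}\|\big)^2\big]<\infty$; (ii) $\max_{1\le m\le m_n}\|\Delta\mathbf S_{n,m}\|\to 0$ in probability; (iii) $\sum_{m=1}^{m_n}\Delta S_{n,m,i}\,\Delta S_{n,m,j}\to\sigma_{ij}$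 in probability for all $1\le i,j\le q$; (iv) $\sum_{m=1}^{m_n}\mathbb E[\Delta\mathbf S_{n,m}\mid\mathcal F_{n,m-1}]\to 0$ in probability; (v) $\sum_{m=1}^{m_n}\mathbb E[\Delta S_{n,m,i}\mid\mathcal F_{n,m-1}]\,\mathbb E[\Delta S_{n,m,j}\mid\mathcal F_{n,m-1}]\to 0$ in probability for all $1\le i,j\le q$. Then $\Sigma$ is positive semidefinite, and $\mathbf S_{n,m_n}$ converges in distribution to the (possibly degenerate) centred normal distribution $\mathcal N(0,\Sigma)$ with covariance matrix $\Sigma$. -/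

import Mathlib

open MeasureTheory ProbabilityTheory Filter Topology
open scoped NNReal ENNReal

namespace NearMartingale

/-- Convergence in probability to a constant `c`, for random elements `X n` that may live on
different probability spaces `(Ω n, P n)`. -/
def TendstoInProbability {Ω : ℕ → Type*} [∀ n, MeasurableSpace (Ω n)]
    (P : ∀ n, Measure (Ω n)) {E : Type*} [PseudoMetricSpace E]
    (X : ∀ n, Ω n → E) (c : E) : Prop :=
  ∀ ε : ℝ, 0 < ε → Tendsto (fun n => P n {ω | ε ≤ dist (X n ω) c}) atTop (𝓝 0)

/-- The increment `S k - S (k - 1)` of a sequence of vectors (used for `1 ≤ k`). -/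
def increment {Ω : Type*} {q : ℕ} (S : ℕ → Ω → Fin q → ℝ) (k : ℕ) (ω : Ω) : Fin q → ℝ :=
  S k ω - S (k - 1) ω

/-- The largest norm of the increments with index `1 ≤ k ≤ m` (it is `0` if `m = 0`); the norm on
`Fin q → ℝ` is the maximum norm. -/
noncomputable def maxIncrement {Ω : Type*} {q : ℕ} (S : ℕ → Ω → Fin q → ℝ) (m : ℕ) (ω : Ω) :
    ℝ≥0 :=
  (Finset.Icc 1 m).sup fun k => ‖increment S k ω‖₊

/-- The conditional expectation of the `k`-th increment given `ℱ (k - 1)`, taken coordinatewise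
(used for `1 ≤ k`). -/
noncomputable def condIncrement {Ω : Type*} [mΩ : MeasurableSpace Ω] (P : Measure Ω)
    (ℱ : Filtration ℕ mΩ) {q : ℕ} (S : ℕ → Ω → Fin q → ℝ) (k : ℕ) (ω : Ω) : Fin q → ℝ :=
  fun i => (P[fun ω' => increment S k ω' i | ℱ (k - 1)]) ω

end NearMartingale

namespace NearMartingale

/-! ### Complex exponentials and products -/

/-! By Lévy's continuity theorem it suffices to treat each projection on a vector `t`. Let x_k be
its increments, y_k their conditional means and c = t·Σt. Since 1 + ia = exp(ia + a²/2 + O(|a|³)),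
the product T = ∏(1 + i(x_k - y_k)) is close to exp(i∑x_k + c/2) when all x_k, ∑y_k and ∑y_k² are
small and ∑x_k² is near c (`norm_exp_sub_mul_prod_le`). The factors are one plus martingale
differences, so E T should be 1. Stopping T once ∑x² or ∑y² passes a fixed level makes this rigorous
(`integrable_and_integral_stoppedProd_eq_one`) and bounds T in L² by the largest increment
(`norm_stoppedProd_sq_le`); with probability tending to one nothing is stopped. Hence exp(i∑x_k) -
exp(-c/2)T is bounded in L² and tends to 0 in probability, so its mean tends to 0. Positive
semidefiniteness passes to the limit from ∑x_k² ≥ 0, and symmetry follows from uniqueness of limits.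
-/

lemma exists_one_add_I_mul_eq_exp {a : ℝ} (ha : |a| ≤ 1 / 2) :
    ∃ r : ℂ, ‖r‖ ≤ |a| ^ 3 ∧
      1 + Complex.I * a = Complex.exp (Complex.I * a + (a : ℂ) ^ 2 / 2 + r) := by
  have hn : ‖Complex.I * (a : ℂ)‖ = |a| := by simp
  have h1 : ‖Complex.I * (a : ℂ)‖ < 1 := by rw [hn]; linarith
  have htaylor : Complex.logTaylor 3 (Complex.I * a) = Complex.I * a + (a : ℂ) ^ 2 / 2 := by
    simp [Complex.logTaylor_succ, Complex.logTaylor_zero, mul_pow]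
    ring
  refine ⟨Complex.log (1 + Complex.I * a) - (Complex.I * a + (a : ℂ) ^ 2 / 2), ?_, ?_⟩
  · have h := Complex.norm_log_sub_logTaylor_le 2 h1
    rw [htaylor, hn] at h
    refine h.trans ?_
    have h2 : (1 - |a|)⁻¹ ≤ 2 := by
      rw [inv_le_comm₀ (by linarith) (by norm_num)]; linarith
    have h3 : 0 ≤ |a| ^ 3 := by positivity
    norm_num
    nlinarith
  · rw [add_sub_cancel, Complex.exp_log]
    intro h0
    have := congrArg Complex.re h0
    simp at this

lemma exists_prod_one_add_I_mul_eq_exp {ι : Type*} (s : Finset ι) (a : ι → ℝ) {δ : ℝ}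
    (hδ : δ ≤ 1 / 2) (ha : ∀ k ∈ s, |a k| ≤ δ) :
    ∃ r : ℂ, ‖r‖ ≤ δ * ∑ k ∈ s, a k ^ 2 ∧
      ∏ k ∈ s, (1 + Complex.I * a k) =
        Complex.exp (Complex.I * ∑ k ∈ s, (a k : ℂ) + (∑ k ∈ s, (a k : ℂ) ^ 2) / 2 + r) := by
  have h : ∀ k : ι, ∃ r : ℂ, k ∈ s → ‖r‖ ≤ |a k| ^ 3 ∧
      1 + Complex.I * a k = Complex.exp (Complex.I * a k + (a k : ℂ) ^ 2 / 2 + r) := by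
    intro k
    by_cases hk : k ∈ s
    · obtain ⟨r, hr⟩ := exists_one_add_I_mul_eq_exp ((ha k hk).trans hδ)
      exact ⟨r, fun _ => hr⟩
    · exact ⟨0, fun h => absurd h hk⟩
  choose r hr using h
  refine ⟨∑ k ∈ s, r k, ?_, ?_⟩
  · refine (norm_sum_le _ _).trans ?_
    rw [Finset.mul_sum]
    refine Finset.sum_le_sum fun k hk => (hr k hk).1.trans ?_
    rw [pow_succ', sq_abs]
    exact mul_le_mul_of_nonneg_right (ha k hk) (sq_nonneg _)
  · rw [Finset.prod_congr rfl fun k hk => (hr k hk).2, ← Complex.exp_sum]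
    simp only [Finset.sum_add_distrib, Finset.mul_sum, Finset.sum_div]

/-- The two terms differ by a factor exp z, and |exp z - 1| ≤ 2|z|. The three parts of z are at most
(c + 4)δ/2, δ and (4c + 8)δ, whence 5c + 11. -/
lemma norm_exp_sub_mul_prod_le {ι : Type*} (s : Finset ι) (x y : ι → ℝ) {c δ : ℝ} (hc : 0 ≤ c)
    (hδ : 0 < δ) (hδ1 : (5 * c + 11) * δ ≤ 1) (hx : ∀ k ∈ s, |x k| ≤ δ)
    (hx2 : |∑ k ∈ s, x k ^ 2 - c| ≤ δ) (hy : |∑ k ∈ s, y k| ≤ δ) (hy2 : ∑ k ∈ s, y k ^ 2 ≤ δ ^ 2) :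
    ‖Complex.exp (Complex.I * (∑ k ∈ s, x k : ℝ)) -
      Real.exp (-c / 2) * ∏ k ∈ s, (1 + Complex.I * (x k - y k : ℝ))‖ ≤ 2 * (5 * c + 11) * δ := by
  have hcδ : 0 ≤ c * δ := by positivity
  have hδ11 : δ ≤ 1 / 11 := by nlinarith
  have hyk : ∀ k ∈ s, |y k| ≤ δ := fun k hk =>
    abs_le_of_sq_le_sq
      ((Finset.single_le_sum (f := fun k => y k ^ 2) (fun i _ => sq_nonneg _) hk).trans hy2) hδ.le
  have hxy : ∀ k ∈ s, |x k - y k| ≤ 2 * δ := fun k hk => by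
    have := abs_sub (x k) (y k)
    linarith [hx k hk, hyk k hk]
  obtain ⟨r, hr, hprod⟩ := exists_prod_one_add_I_mul_eq_exp s (fun k => x k - y k)
    (by linarith : 2 * δ ≤ 1 / 2) hxy
  -- Weighted AM-GM with weight δ; the bound δ² on ∑y² absorbs the factor δ⁻¹.
  have hcross : |2 * ∑ k ∈ s, x k * y k| ≤ δ * (c + 2) := by
    have h1 : |2 * ∑ k ∈ s, x k * y k| ≤ ∑ k ∈ s, (δ * x k ^ 2 + δ⁻¹ * y k ^ 2) := by
      rw [Finset.mul_sum]
      refine (Finset.abs_sum_le_sum_abs _ _).trans (Finset.sum_le_sum fun k _ => ?_)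
      have e1 : 0 ≤ δ⁻¹ * (δ * x k - y k) ^ 2 := by positivity
      have e2 : 0 ≤ δ⁻¹ * (δ * x k + y k) ^ 2 := by positivity
      have e3 : δ⁻¹ * (δ * x k - y k) ^ 2 =
        δ * x k ^ 2 + δ⁻¹ * y k ^ 2 - 2 * (x k * y k) := by field_simp; ring
      have e4 : δ⁻¹ * (δ * x k + y k) ^ 2 =
        δ * x k ^ 2 + δ⁻¹ * y k ^ 2 + 2 * (x k * y k) := by field_simp; ring
      rw [abs_le]
      constructor <;> linarith
    rw [Finset.sum_add_distrib, ← Finset.mul_sum, ← Finset.mul_sum] at h1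
    have h2 : δ⁻¹ * ∑ k ∈ s, y k ^ 2 ≤ δ := by
      rw [inv_mul_le_iff₀ hδ]; nlinarith
    have h3 : δ * ∑ k ∈ s, x k ^ 2 ≤ δ * (c + 1) :=
      mul_le_mul_of_nonneg_left (by linarith [(abs_le.1 hx2).2]) hδ.le
    linarith
  have hy0 : 0 ≤ ∑ k ∈ s, y k ^ 2 := Finset.sum_nonneg fun k _ => sq_nonneg _
  have hsq : |∑ k ∈ s, (x k - y k) ^ 2 - c| ≤ δ * (c + 4) := by
    have e : ∑ k ∈ s, (x k - y k) ^ 2 =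
        ∑ k ∈ s, x k ^ 2 - 2 * ∑ k ∈ s, x k * y k + ∑ k ∈ s, y k ^ 2 := by
      rw [Finset.mul_sum, ← Finset.sum_sub_distrib, ← Finset.sum_add_distrib]
      exact Finset.sum_congr rfl fun k _ => by ring
    rw [e]
    have := abs_le.1 hcross
    have := abs_le.1 hx2
    rw [abs_le]
    constructor <;> nlinarith
  have hr' : ‖r‖ ≤ δ * (4 * c + 8) := by
    refine hr.trans ?_
    have := (abs_le.1 hsq).2
    nlinarith
  set z : ℂ := ((∑ k ∈ s, (x k - y k) ^ 2 - c) / 2 : ℝ) - Complex.I * (∑ k ∈ s, y k : ℝ) + r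
  have hz : ‖z‖ ≤ (5 * c + 11) * δ := by
    have h1 : ‖((((∑ k ∈ s, (x k - y k) ^ 2 - c) / 2 : ℝ)) : ℂ)‖ ≤ δ * (c + 4) / 2 := by
      rw [Complex.norm_real, Real.norm_eq_abs, abs_div, abs_two]
      linarith
    have h2 : ‖Complex.I * ((∑ k ∈ s, y k : ℝ) : ℂ)‖ ≤ δ := by
      rw [norm_mul, Complex.norm_I, one_mul, Complex.norm_real]
      exact hy
    have := (norm_add_le (((((∑ k ∈ s, (x k - y k) ^ 2 - c) / 2 : ℝ)) : ℂ) -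
      Complex.I * ((∑ k ∈ s, y k : ℝ) : ℂ)) r)
    have := norm_sub_le ((((∑ k ∈ s, (x k - y k) ^ 2 - c) / 2 : ℝ)) : ℂ)
      (Complex.I * ((∑ k ∈ s, y k : ℝ) : ℂ))
    nlinarith
  have hfac : Complex.exp (Complex.I * (∑ k ∈ s, x k : ℝ)) -
      Real.exp (-c / 2) * ∏ k ∈ s, (1 + Complex.I * (x k - y k : ℝ)) =
      -(Complex.exp (Complex.I * (∑ k ∈ s, x k : ℝ)) * (Complex.exp z - 1)) := by
    rw [hprod, mul_sub, ← Complex.exp_add, Complex.ofReal_exp, ← Complex.exp_add]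
    have : ((-c / 2 : ℝ) : ℂ) + (Complex.I * ∑ k ∈ s, ((x k - y k : ℝ) : ℂ) +
        (∑ k ∈ s, ((x k - y k : ℝ) : ℂ) ^ 2) / 2 + r) =
        Complex.I * (∑ k ∈ s, x k : ℝ) + z := by
      simp only [z]
      push_cast
      rw [Finset.sum_sub_distrib]
      ring
    rw [this]
    ring
  rw [hfac, norm_neg, norm_mul, mul_comm Complex.I, Complex.norm_exp_ofReal_mul_I, one_mul]
  have := Complex.norm_exp_sub_one_le (hz.trans hδ1)
  linarith

lemma norm_one_add_I_mul_sq (a : ℝ) : ‖1 + Complex.I * (a : ℂ)‖ ^ 2 = 1 + a ^ 2 := by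
  rw [← Complex.normSq_eq_norm_sq, Complex.normSq_apply]
  simp
  ring

/-! ### Stopped product -/

/-- Indicator that the quadratic variation of `x` before time `k` and that of the predictable
sequence `y` up to time `k` are still below fixed levels. -/
noncomputable def stopInd (c : ℝ) (x y : ℕ → ℝ) (k : ℕ) : ℝ :=
  open Classical in
  if ∑ j ∈ Finset.range k, x j ^ 2 ≤ c + 1 ∧ ∑ j ∈ Finset.range (k + 1), y j ^ 2 ≤ 1 then 1 else 0

/-- The product of the factors `1 + i (x j - y j)`, stopped according to `stopInd`. -/
noncomputable def stoppedProd (c : ℝ) (x y : ℕ → ℝ) (n : ℕ) : ℂ :=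
  ∏ j ∈ Finset.range n, (1 + Complex.I * (stopInd c x y j * (x j - y j) : ℝ))

lemma stoppedProd_succ (c : ℝ) (x y : ℕ → ℝ) (n : ℕ) :
    stoppedProd c x y (n + 1) =
      stoppedProd c x y n * (1 + Complex.I * (stopInd c x y n * (x n - y n) : ℝ)) :=
  Finset.prod_range_succ _ _

lemma stopInd_eq_zero_or_one (c : ℝ) (x y : ℕ → ℝ) (k : ℕ) :
    stopInd c x y k = 0 ∨ stopInd c x y k = 1 := by
  unfold stopInd
  split_ifs <;> simp

lemma stopInd_eq_one_iff {c : ℝ} {x y : ℕ → ℝ} {k : ℕ} :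
    stopInd c x y k = 1 ↔
      ∑ j ∈ Finset.range k, x j ^ 2 ≤ c + 1 ∧ ∑ j ∈ Finset.range (k + 1), y j ^ 2 ≤ 1 := by
  unfold stopInd
  split_ifs with h <;> simp [h]

/-- Each squared factor is at most exp(2x² + 2y²), and the levels c + 1 and 1 give the exponent 2(c
+ 1) + 2. -/
lemma norm_stoppedProd_sq_le_of_stopInd {c : ℝ} {x y : ℕ → ℝ} {k : ℕ}
    (h : stopInd c x y k = 1) : ‖stoppedProd c x y k‖ ^ 2 ≤ Real.exp (2 * c + 4) := by
  obtain ⟨hx, hy⟩ := stopInd_eq_one_iff.1 h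
  have hy' : ∑ j ∈ Finset.range k, y j ^ 2 ≤ 1 := by
    rw [Finset.sum_range_succ] at hy
    linarith [sq_nonneg (y k)]
  rw [stoppedProd, norm_prod, ← Finset.prod_pow]
  calc ∏ j ∈ Finset.range k, ‖1 + Complex.I * ((stopInd c x y j * (x j - y j) : ℝ) : ℂ)‖ ^ 2
      ≤ ∏ j ∈ Finset.range k, Real.exp (2 * x j ^ 2 + 2 * y j ^ 2) := by
        refine Finset.prod_le_prod (fun j _ => by positivity) fun j _ => ?_
        rw [norm_one_add_I_mul_sq]
        refine le_trans ?_ (Real.add_one_le_exp _)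
        rcases stopInd_eq_zero_or_one c x y j with h | h <;> rw [h] <;>
          nlinarith [sq_nonneg (x j + y j), sq_nonneg (x j), sq_nonneg (y j)]
    _ = Real.exp (2 * ∑ j ∈ Finset.range k, x j ^ 2 + 2 * ∑ j ∈ Finset.range k, y j ^ 2) := by
        rw [← Real.exp_sum, Finset.sum_add_distrib, Finset.mul_sum, Finset.mul_sum]
    _ ≤ _ := Real.exp_le_exp.2 (by linarith)

/-- Only the last active factor can overshoot the level, and it costs at most 1 + 2x² + 2y² ≤ 3 +
2z². -/
lemma norm_stoppedProd_sq_le {c : ℝ} (hc : 0 ≤ c) {x y : ℕ → ℝ} {z : ℝ} {n : ℕ}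
    (hz : ∀ k < n, |x k| ≤ z) :
    ‖stoppedProd c x y n‖ ^ 2 ≤ Real.exp (2 * c + 4) * (3 + 2 * z ^ 2) := by
  induction n with
  | zero =>
    have : 1 ≤ Real.exp (2 * c + 4) := Real.one_le_exp (by linarith)
    simp only [stoppedProd, Finset.range_zero, Finset.prod_empty, norm_one, one_pow]
    nlinarith [sq_nonneg z]
  | succ n ih =>
    rw [stoppedProd_succ]
    rcases stopInd_eq_zero_or_one c x y n with h | h
    · simpa [h] using ih fun k hk => hz k (hk.trans n.lt_succ_self)
    · rw [norm_mul, mul_pow, norm_one_add_I_mul_sq, h, one_mul]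
      refine mul_le_mul (norm_stoppedProd_sq_le_of_stopInd h) ?_ (by positivity) (by positivity)
      have hy := (stopInd_eq_one_iff.1 h).2
      have hyn : y n ^ 2 ≤ 1 := (Finset.single_le_sum (f := fun j => y j ^ 2)
        (fun i _ => sq_nonneg _) (Finset.self_mem_range_succ n)).trans hy
      have hxn : x n ^ 2 ≤ z ^ 2 := by
        rw [← sq_abs (x n)]
        exact pow_le_pow_left₀ (abs_nonneg _) (hz n n.lt_succ_self) 2
      nlinarith [sq_nonneg (x n + y n)]

lemma stoppedProd_eq_of_le {c : ℝ} {x y : ℕ → ℝ} {n : ℕ}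
    (hx : ∑ j ∈ Finset.range n, x j ^ 2 ≤ c + 1) (hy : ∑ j ∈ Finset.range n, y j ^ 2 ≤ 1) :
    stoppedProd c x y n = ∏ j ∈ Finset.range n, (1 + Complex.I * (x j - y j : ℝ)) := by
  refine Finset.prod_congr rfl fun j hj => ?_
  have hj' := Finset.mem_range.1 hj
  rw [stopInd_eq_one_iff.2 ⟨le_trans ?_ hx, le_trans ?_ hy⟩, one_mul]
  · exact Finset.sum_le_sum_of_subset_of_nonneg (Finset.range_mono hj'.le)
      fun _ _ _ => sq_nonneg _
  · exact Finset.sum_le_sum_of_subset_of_nonneg (Finset.range_mono hj')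
      fun _ _ _ => sq_nonneg _

/-! ### The stopped product has expectation one -/

section Integral

variable {Ω : Type*} {mΩ : MeasurableSpace Ω}

lemma integral_mul_sub_condExp_eq_zero {Ω : Type*} {m mΩ : MeasurableSpace Ω} {P : Measure Ω}
    [IsFiniteMeasure P] (hm : m ≤ mΩ) {f : Ω → ℂ} {X Y : Ω → ℝ} {C : ℝ}
    (hf : StronglyMeasurable[m] f) (hfC : ∀ ω, ‖f ω‖ ≤ C) (hX : Integrable X P)
    (hY : Y =ᵐ[P] P[X | m]) : ∫ ω, f ω * ((X ω - Y ω : ℝ) : ℂ) ∂P = 0 := by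
  have hf' : AEStronglyMeasurable f P := (hf.mono hm).aestronglyMeasurable
  have hYi : Integrable Y P := integrable_condExp.congr hY.symm
  have hfX : Integrable (fun ω => f ω * (X ω : ℂ)) P :=
    hX.ofReal.bdd_mul hf' (ae_of_all _ hfC)
  have hfY : Integrable (fun ω => f ω * (Y ω : ℂ)) P :=
    hYi.ofReal.bdd_mul hf' (ae_of_all _ hfC)
  -- Complex times real as a real bilinear map, so that the pull-out property applies to factors of
  -- different types.
  have hB : ∀ (z : ℂ) (r : ℝ), (ContinuousLinearMap.lsmul ℝ ℝ (E := ℂ)).flip z r = z * (r : ℂ) :=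
    fun z r => by simp [mul_comm]
  have key := condExp_bilin_of_stronglyMeasurable_left (m := m) (μ := P)
    (ContinuousLinearMap.lsmul ℝ ℝ (E := ℂ)).flip hf (g := X) (by simpa only [hB] using hfX) hX
  simp only [hB] at key
  have h1 : ∫ ω, f ω * (X ω : ℂ) ∂P = ∫ ω, f ω * (Y ω : ℂ) ∂P := by
    rw [← integral_condExp hm (f := fun ω => f ω * (X ω : ℂ)), integral_congr_ae key]
    refine integral_congr_ae ?_
    filter_upwards [hY] with ω hω
    rw [hω]
  simp only [Complex.ofReal_sub, mul_sub]
  rw [integral_sub hfX hfY, h1, sub_self]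

/-- Using `X` strictly before `k` but `Y` up to `k` makes the indicator predictable, since `Y k` is
known one step earlier than `X k`. -/
lemma measurable_stopInd {m : MeasurableSpace Ω} {c : ℝ} {X Y : ℕ → Ω → ℝ} {k : ℕ}
    (hX : ∀ j < k, Measurable[m] (X j)) (hY : ∀ j ≤ k, Measurable[m] (Y j)) :
    Measurable[m] fun ω => stopInd c (fun j => X j ω) (fun j => Y j ω) k := by
  have h1 : Measurable[m] fun ω => ∑ j ∈ Finset.range k, X j ω ^ 2 :=
    Finset.measurable_fun_sum _ fun j hj => (hX j (Finset.mem_range.1 hj)).pow_const 2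
  have h2 : Measurable[m] fun ω => ∑ j ∈ Finset.range (k + 1), Y j ω ^ 2 :=
    Finset.measurable_fun_sum _ fun j hj => (hY j (Finset.mem_range_succ_iff.1 hj)).pow_const 2
  unfold stopInd
  exact Measurable.ite ((measurableSet_le h1 measurable_const).inter
    (measurableSet_le h2 measurable_const)) measurable_const measurable_const

lemma measurable_stoppedProd {m : MeasurableSpace Ω} {c : ℝ} {X Y : ℕ → Ω → ℝ} {n : ℕ}
    (hX : ∀ j < n, Measurable[m] (X j)) (hY : ∀ j < n, Measurable[m] (Y j)) :
    Measurable[m] fun ω => stoppedProd c (fun j => X j ω) (fun j => Y j ω) n := by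
  unfold stoppedProd
  refine Finset.measurable_fun_prod _ fun j hj => ?_
  have hj' := Finset.mem_range.1 hj
  exact measurable_const.add (measurable_const.mul (Complex.measurable_ofReal.comp
    ((measurable_stopInd (fun i hi => hX i (hi.trans hj')) (fun i hi => hY i (hi.trans_lt hj'))).mul
      ((hX j hj').sub (hY j hj')))))

/-- Each step adds `f * (X n - Y n)`, where `f` is known at time `n` and is bounded because of the
indicator, so the added term has mean zero. -/
lemma integrable_and_integral_stoppedProd_eq_one {P : Measure Ω} [IsProbabilityMeasure P]
    (ℱ : Filtration ℕ mΩ) {X Y : ℕ → Ω → ℝ} (c : ℝ) {n : ℕ}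
    (hX : ∀ k < n, Measurable[ℱ (k + 1)] (X k)) (hY : ∀ k < n, Measurable[ℱ k] (Y k))
    (hXi : ∀ k < n, Integrable (X k) P) (hXY : ∀ k < n, Y k =ᵐ[P] P[X k | ℱ k]) :
    Integrable (fun ω => stoppedProd c (fun j => X j ω) (fun j => Y j ω) n) P ∧
      ∫ ω, stoppedProd c (fun j => X j ω) (fun j => Y j ω) n ∂P = 1 := by
  induction n with
  | zero => simp [stoppedProd]
  | succ n ih =>
    obtain ⟨ih1, ih2⟩ := ih (fun k hk => hX k (hk.trans n.lt_succ_self))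
      (fun k hk => hY k (hk.trans n.lt_succ_self)) (fun k hk => hXi k (hk.trans n.lt_succ_self))
      (fun k hk => hXY k (hk.trans n.lt_succ_self))
    set f : Ω → ℂ := fun ω => Complex.I * (stoppedProd c (fun j => X j ω) (fun j => Y j ω) n *
      (stopInd c (fun j => X j ω) (fun j => Y j ω) n : ℂ)) with hf
    have hXn : ∀ j < n, Measurable[ℱ n] (X j) := fun j hj =>
      (hX j (hj.trans n.lt_succ_self)).mono (ℱ.mono hj) le_rfl
    have hYn : ∀ j ≤ n, Measurable[ℱ n] (Y j) := fun j hj =>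
      (hY j (Nat.lt_succ_of_le hj)).mono (ℱ.mono hj) le_rfl
    have hfm : StronglyMeasurable[ℱ n] f := Measurable.stronglyMeasurable <|
      measurable_const.mul ((measurable_stoppedProd hXn fun j hj => hYn j hj.le).mul
        (Complex.measurable_ofReal.comp (measurable_stopInd hXn hYn)))
    have hfC : ∀ ω, ‖f ω‖ ≤ Real.sqrt (Real.exp (2 * c + 4)) := fun ω => by
      simp only [hf, norm_mul, Complex.norm_I, one_mul, Complex.norm_real]
      rcases stopInd_eq_zero_or_one c (fun j => X j ω) (fun j => Y j ω) n with h | h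
      · simp [h, Real.sqrt_nonneg]
      · rw [h, norm_one, mul_one]
        exact Real.le_sqrt_of_sq_le (norm_stoppedProd_sq_le_of_stopInd h)
    have hsucc : ∀ ω, stoppedProd c (fun j => X j ω) (fun j => Y j ω) (n + 1) =
        stoppedProd c (fun j => X j ω) (fun j => Y j ω) n + f ω * ((X n ω - Y n ω : ℝ) : ℂ) := by
      intro ω
      rw [stoppedProd_succ, hf]
      push_cast
      ring
    have hYi : Integrable (Y n) P := integrable_condExp.congr (hXY n n.lt_succ_self).symm
    have hfi : Integrable (fun ω => f ω * ((X n ω - Y n ω : ℝ) : ℂ)) P :=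
      ((hXi n n.lt_succ_self).sub hYi).ofReal.bdd_mul
        (hfm.mono (ℱ.le n)).aestronglyMeasurable (ae_of_all _ hfC)
    simp only [hsucc]
    refine ⟨ih1.add hfi, ?_⟩
    rw [integral_add ih1 hfi, ih2, integral_mul_sub_condExp_eq_zero (ℱ.le n) hfm hfC
      (hXi n n.lt_succ_self) (hXY n n.lt_succ_self), add_zero]

end Integral

end NearMartingale

namespace NearMartingale

/-! ### Convergence in probability -/

section Probability

variable {Ω : ℕ → Type*} [mΩ : ∀ n, MeasurableSpace (Ω n)] {P : ∀ n, Measure (Ω n)}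
  {E F : Type*} [PseudoMetricSpace E] [PseudoMetricSpace F]

lemma TendstoInProbability.comp_continuousAt {X : ∀ n, Ω n → E} {c : E}
    (hX : TendstoInProbability P X c) {f : E → F} (hf : ContinuousAt f c) :
    TendstoInProbability P (fun n ω => f (X n ω)) (f c) := by
  intro ε hε
  obtain ⟨δ, hδ, h⟩ := Metric.continuousAt_iff.1 hf ε hε
  refine tendsto_of_tendsto_of_tendsto_of_le_of_le tendsto_const_nhds (hX δ hδ)
    (fun _ => zero_le) fun n => measure_mono fun ω hω => ?_
  by_contra hlt
  exact absurd (h (not_le.1 hlt)) (not_lt.2 hω)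

lemma TendstoInProbability.pi {ι : Type*} [Fintype ι] {X : ∀ n, Ω n → ι → E} {c : ι → E}
    (hX : ∀ i, TendstoInProbability P (fun n ω => X n ω i) (c i)) :
    TendstoInProbability P X c := by
  intro ε hε
  have hsum : Tendsto (fun n => ∑ i, P n {ω | ε ≤ dist (X n ω i) (c i)}) atTop (𝓝 0) := by
    simpa using tendsto_finsetSum Finset.univ fun i _ => hX i ε hε
  refine tendsto_of_tendsto_of_tendsto_of_le_of_le tendsto_const_nhds hsum
    (fun _ => zero_le) fun n => ?_
  refine (measure_mono (t := ⋃ i ∈ Finset.univ, {ω | ε ≤ dist (X n ω i) (c i)}) ?_).trans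
    (measure_biUnion_finset_le _ _)
  intro ω hω
  by_contra hlt
  simp only [Finset.mem_univ, Set.iUnion_true, Set.mem_iUnion, Set.mem_ofPred_eq, not_exists,
    not_le] at hlt
  exact absurd ((dist_pi_lt_iff hε).2 hlt) (not_lt.2 hω)

/-- Otherwise every point is at least half of `dist a b` away from `a` or from `b`, so the two
probabilities sum to at least one. -/
lemma TendstoInProbability.dist_eq_zero [∀ n, IsProbabilityMeasure (P n)] {X : ∀ n, Ω n → E}
    {a b : E} (ha : TendstoInProbability P X a) (hb : TendstoInProbability P X b) :
    dist a b = 0 := by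
  by_contra hne
  have hpos : 0 < dist a b / 2 := half_pos (lt_of_le_of_ne dist_nonneg (Ne.symm hne))
  have hsum := (ha _ hpos).add (hb _ hpos)
  rw [add_zero] at hsum
  refine absurd (ge_of_tendsto' hsum fun n => ?_) (not_le.2 (zero_lt_one (α := ℝ≥0∞)))
  rw [← measure_univ (μ := P n)]
  refine (measure_mono fun ω _ => ?_).trans (measure_union_le _ _)
  by_contra hlt
  simp only [Set.mem_union, Set.mem_ofPred_eq, not_or, not_le] at hlt
  have := dist_triangle_left a b (X n ω)
  linarith

lemma TendstoInProbability.nonneg [∀ n, IsProbabilityMeasure (P n)] {X : ∀ n, Ω n → ℝ}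
    {c : ℝ} (hX : TendstoInProbability P X c) (h : ∀ n ω, 0 ≤ X n ω) : 0 ≤ c := by
  have habs := hX.comp_continuousAt (f := fun x : ℝ => |x|) continuous_abs.continuousAt
  simp only [abs_of_nonneg (h _ _)] at habs
  have := dist_eq_zero hX habs
  rw [_root_.dist_eq_zero] at this
  rw [this]
  exact abs_nonneg c

/-- L²-boundedness supplies uniform integrability, here through the pointwise bound |D| ≤ η + η|D|²
+ η⁻¹·1{|D| ≥ η}. -/
lemma tendsto_integral_zero_of_lintegral_sq_le [∀ n, IsProbabilityMeasure (P n)]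
    {D : ∀ n, Ω n → ℂ} {K : ℝ≥0} (hDm : ∀ n, AEStronglyMeasurable (D n) (P n))
    (hK : ∀ n, ∫⁻ ω, ‖D n ω‖ₑ ^ 2 ∂(P n) ≤ K) (hD : TendstoInProbability P D 0) :
    Tendsto (fun n => ∫ ω, D n ω ∂(P n)) atTop (𝓝 0) := by
  have hpt : ∀ (η : ℝ≥0), 0 < η → ∀ n ω, ‖D n ω‖ₑ ≤
      η + (η * ‖D n ω‖ₑ ^ 2 + {ω | (η : ℝ) ≤ dist (D n ω) 0}.indicator
        (fun _ => ((η⁻¹ : ℝ≥0) : ℝ≥0∞)) ω) := by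
    intro η hη n ω
    by_cases h : (η : ℝ) ≤ dist (D n ω) 0
    · rw [Set.indicator_of_mem (by exact h), enorm_eq_nnnorm]
      norm_cast
      rw [← NNReal.coe_le_coe]
      push_cast
      have hη' : (0 : ℝ) < η := hη
      have h0 : 0 ≤ (η : ℝ)⁻¹ * (η * ‖D n ω‖ - 1) ^ 2 := by positivity
      have e : (η : ℝ)⁻¹ * (η * ‖D n ω‖ - 1) ^ 2 =
        η * ‖D n ω‖ ^ 2 + (η : ℝ)⁻¹ - 2 * ‖D n ω‖ := by field_simp; ring
      have := norm_nonneg (D n ω)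
      linarith
    · refine le_trans ?_ le_self_add
      rw [dist_zero_right, not_le] at h
      rw [enorm_eq_nnnorm]
      exact_mod_cast h.le
  have hbound : ∀ (η : ℝ≥0), 0 < η → ∀ n, ∫⁻ ω, ‖D n ω‖ₑ ∂(P n) ≤
      η + (η * K + (η⁻¹ : ℝ≥0) * P n {ω | (η : ℝ) ≤ dist (D n ω) 0}) := by
    intro η hη n
    refine (lintegral_mono (hpt η hη n)).trans ?_
    rw [lintegral_add_left measurable_const, lintegral_const, measure_univ, mul_one]
    refine add_le_add le_rfl ?_
    rw [lintegral_add_left' (((hDm n).enorm.pow_const 2).const_mul _),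
      lintegral_const_mul' _ _ ENNReal.coe_ne_top]
    exact add_le_add (mul_le_mul' le_rfl (hK n)) (lintegral_indicator_const_le _ _)
  have hlim : Tendsto (fun n => ∫⁻ ω, ‖D n ω‖ₑ ∂(P n)) atTop (𝓝 0) := by
    rw [ENNReal.tendsto_nhds_zero]
    intro ε hε
    obtain ⟨ε', hε', hεε⟩ := ENNReal.lt_iff_exists_nnreal_btwn.1 hε
    have hε'0 : 0 < ε' := by exact_mod_cast hε'
    set η : ℝ≥0 := ε' / (2 * (1 + K)) with hη
    have hη0 : 0 < η := by positivity
    have hηK : η + η * K = ε' / 2 := by rw [hη]; field_simp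
    have hprob := ENNReal.Tendsto.const_mul (a := ((η⁻¹ : ℝ≥0) : ℝ≥0∞)) (hD η hη0)
      (Or.inr ENNReal.coe_ne_top)
    rw [mul_zero] at hprob
    have hhalf : (0 : ℝ≥0∞) < ((ε' / 2 : ℝ≥0) : ℝ≥0∞) := by
      exact_mod_cast half_pos hε'0
    filter_upwards [ENNReal.tendsto_nhds_zero.1 hprob _ hhalf] with n hn
    calc ∫⁻ ω, ‖D n ω‖ₑ ∂(P n)
        ≤ η + (η * K + (η⁻¹ : ℝ≥0) * P n {ω | (η : ℝ) ≤ dist (D n ω) 0}) := hbound η hη0 n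
      _ ≤ η + (η * K + ((ε' / 2 : ℝ≥0) : ℝ≥0∞)) := by gcongr
      _ = ((η + η * K + ε' / 2 : ℝ≥0) : ℝ≥0∞) := by push_cast; rw [add_assoc]
      _ = ε' := by rw [hηK, add_halves]
      _ ≤ ε := hεε.le
  rw [tendsto_zero_iff_enorm_tendsto_zero]
  exact tendsto_of_tendsto_of_tendsto_of_le_of_le tendsto_const_nhds hlim (fun _ => zero_le)
    fun n => enorm_integral_le_lintegral_enorm _

/-! ### Convergence of the Fourier transforms in dimension one -/

theorem tendsto_integral_exp_I_mul_sum [∀ n, IsProbabilityMeasure (P n)] {m : ℕ → ℕ}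
    (ℱ : ∀ n, Filtration ℕ (mΩ n)) {X Y : ∀ n, ℕ → Ω n → ℝ} {Z : ∀ n, Ω n → ℝ} {c : ℝ} {C : ℝ≥0}
    (hX : ∀ n, ∀ k < m n, Measurable[ℱ n (k + 1)] (X n k))
    (hY : ∀ n, ∀ k < m n, Measurable[ℱ n k] (Y n k))
    (hXi : ∀ n, ∀ k < m n, Integrable (X n k) (P n))
    (hXY : ∀ n, ∀ k < m n, Y n k =ᵐ[P n] (P n)[X n k | ℱ n k])
    (hXZ : ∀ n, ∀ k < m n, ∀ ω, |X n k ω| ≤ Z n ω)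
    (hZC : ∀ n, ∫⁻ ω, ‖Z n ω‖ₑ ^ 2 ∂(P n) ≤ C)
    (hZ : TendstoInProbability P Z 0)
    (hqv : TendstoInProbability P (fun n ω => ∑ k ∈ Finset.range (m n), X n k ω ^ 2) c)
    (hYsum : TendstoInProbability P (fun n ω => ∑ k ∈ Finset.range (m n), Y n k ω) 0)
    (hYsq : TendstoInProbability P (fun n ω => ∑ k ∈ Finset.range (m n), Y n k ω ^ 2) 0) :
    Tendsto (fun n => ∫ ω, Complex.exp
      (Complex.I * (∑ k ∈ Finset.range (m n), X n k ω : ℝ)) ∂(P n)) atTop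
      (𝓝 (Real.exp (-c / 2) : ℂ)) := by
  have hc : 0 ≤ c := hqv.nonneg fun n ω => Finset.sum_nonneg fun k _ => sq_nonneg _
  set U : ∀ n, Ω n → ℂ := fun n ω =>
    Complex.exp (Complex.I * (∑ k ∈ Finset.range (m n), X n k ω : ℝ)) with hU
  set T : ∀ n, Ω n → ℂ := fun n ω =>
    stoppedProd c (fun k => X n k ω) (fun k => Y n k ω) (m n) with hT
  set D : ∀ n, Ω n → ℂ := fun n ω => U n ω - Real.exp (-c / 2) * T n ω with hDdef
  have hTi : ∀ n, Integrable (T n) (P n) ∧ ∫ ω, T n ω ∂(P n) = 1 := fun n =>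
    integrable_and_integral_stoppedProd_eq_one (ℱ n) c (hX n) (hY n) (hXi n) (hXY n)
  have hUnorm : ∀ n ω, ‖U n ω‖ = 1 := fun n ω => by
    simp only [hU, mul_comm Complex.I]
    exact Complex.norm_exp_ofReal_mul_I _
  have hUi : ∀ n, Integrable (U n) (P n) := fun n => by
    have hsum : Measurable fun ω => ∑ k ∈ Finset.range (m n), X n k ω :=
      Finset.measurable_fun_sum _ fun k hk =>
        (hX n k (Finset.mem_range.1 hk)).mono ((ℱ n).le _) le_rfl
    refine Integrable.of_bound (C := 1) ?_ (ae_of_all _ fun ω => (hUnorm n ω).le)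
    exact (Complex.measurable_exp.comp (measurable_const.mul
      (Complex.measurable_ofReal.comp hsum))).aestronglyMeasurable
  have hDint : ∀ n, ∫ ω, D n ω ∂(P n) = ∫ ω, U n ω ∂(P n) - Real.exp (-c / 2) := fun n => by
    rw [hDdef, integral_sub (hUi n) ((hTi n).1.const_mul _), integral_const_mul, (hTi n).2,
      mul_one]
  have hDprob : TendstoInProbability P D 0 := by
    intro ε hε
    -- Makes the deterministic error 2(5c + 11)δ at most ε/2 off four events of vanishing
    -- probability.
    set δ : ℝ := min 1 ε / (4 * (5 * c + 11)) with hδ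
    have hmin : 0 < min 1 ε := lt_min one_pos hε
    have hδ0 : 0 < δ := by positivity
    have hδe : (5 * c + 11) * δ = min 1 ε / 4 := by rw [hδ]; field_simp
    have hδ1 : (5 * c + 11) * δ ≤ 1 := by rw [hδe]; linarith [min_le_left 1 ε]
    have hδ1' : δ ≤ 1 := by nlinarith
    have hsum := (((hZ δ hδ0).add (hqv δ hδ0)).add (hYsum δ hδ0)).add (hYsq (δ ^ 2) (by positivity))
    simp only [add_zero] at hsum
    refine tendsto_of_tendsto_of_tendsto_of_le_of_le tendsto_const_nhds hsum
      (fun _ => zero_le) fun n => ?_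
    refine le_trans (measure_mono fun ω hω => ?_) ((measure_union_le _ _).trans (add_le_add
      ((measure_union_le _ _).trans (add_le_add (measure_union_le _ _) le_rfl)) le_rfl))
    by_contra hlt
    simp only [Set.mem_union, Set.mem_ofPred_eq, not_or, not_le, Real.dist_eq, sub_zero] at hlt
    obtain ⟨⟨⟨h1, h2⟩, h3⟩, h4⟩ := hlt
    have h4' := (le_abs_self _).trans h4.le
    have hTeq : T n ω = ∏ j ∈ Finset.range (m n), (1 + Complex.I * (X n j ω - Y n j ω : ℝ)) :=
      stoppedProd_eq_of_le (by linarith [(abs_lt.1 h2).2]) (h4'.trans (by nlinarith))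
    have hle := norm_exp_sub_mul_prod_le (Finset.range (m n)) (fun k => X n k ω)
      (fun k => Y n k ω) hc hδ0 hδ1
      (fun k hk => (hXZ n k (Finset.mem_range.1 hk) ω).trans ((le_abs_self _).trans h1.le))
      h2.le h3.le h4'
    rw [← hTeq] at hle
    have hω' : ε ≤ ‖D n ω‖ := by simpa using hω
    have : ‖D n ω‖ ≤ 2 * (5 * c + 11) * δ := hle
    have := min_le_right 1 ε
    linarith
  set K : ℝ≥0 := ⟨Real.exp (2 * c + 4), (Real.exp_pos _).le⟩ with hK
  -- From |D|² ≤ 2 + 2|T|² and |T|² ≤ K(3 + 2Z²).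
  have hDsq : ∀ n, ∫⁻ ω, ‖D n ω‖ₑ ^ 2 ∂(P n) ≤ ((2 + 6 * K + 4 * K * C : ℝ≥0) : ℝ≥0∞) := by
    intro n
    have hpt : ∀ ω, ‖D n ω‖ₑ ^ 2 ≤
        ((2 + 6 * K : ℝ≥0) : ℝ≥0∞) + ((4 * K : ℝ≥0) : ℝ≥0∞) * ‖Z n ω‖ₑ ^ 2 := by
      intro ω
      rw [enorm_eq_nnnorm, enorm_eq_nnnorm]
      norm_cast
      rw [← NNReal.coe_le_coe]
      push_cast
      have hKc : (K : ℝ) = Real.exp (2 * c + 4) := rfl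
      have hTb : ‖T n ω‖ ^ 2 ≤ K * (3 + 2 * Z n ω ^ 2) :=
        norm_stoppedProd_sq_le hc fun k hk => hXZ n k hk ω
      have hDn : ‖D n ω‖ ≤ 1 + ‖T n ω‖ := by
        refine (norm_sub_le _ _).trans ?_
        rw [hUnorm, norm_mul, Complex.norm_real, Real.norm_eq_abs, abs_of_pos (Real.exp_pos _)]
        have : Real.exp (-c / 2) ≤ 1 := Real.exp_le_one_iff.2 (by linarith)
        have := mul_le_of_le_one_left (norm_nonneg (T n ω)) this
        linarith
      have h1 : ‖D n ω‖ ^ 2 ≤ (1 + ‖T n ω‖) ^ 2 := pow_le_pow_left₀ (norm_nonneg _) hDn 2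
      rw [Real.norm_eq_abs, sq_abs]
      nlinarith [sq_nonneg (1 - ‖T n ω‖)]
    refine (lintegral_mono hpt).trans ?_
    rw [lintegral_add_left measurable_const, lintegral_const, measure_univ, mul_one,
      lintegral_const_mul' _ _ ENNReal.coe_ne_top]
    push_cast
    gcongr
    exact hZC n
  have hlim : Tendsto (fun n => ∫ ω, D n ω ∂(P n)) atTop (𝓝 0) :=
    tendsto_integral_zero_of_lintegral_sq_le
      (fun n => ((hUi n).sub ((hTi n).1.const_mul _)).aestronglyMeasurable) hDsq hDprob
  simp only [hDint] at hlim
  simpa [hU] using hlim.add_const (Real.exp (-c / 2) : ℂ)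

end Probability

end NearMartingale

namespace NearMartingale

/-! ### Increments and their linear combinations -/

lemma sum_Icc_one_eq_sum_range {M : Type*} [AddCommMonoid M] (f : ℕ → M) (n : ℕ) :
    ∑ k ∈ Finset.Icc 1 n, f k = ∑ k ∈ Finset.range n, f (k + 1) := by
  induction n with
  | zero => simp
  | succ n ih => rw [Finset.sum_Icc_succ_top (by omega), ih, Finset.sum_range_succ]

lemma abs_increment_le_maxIncrement {Ω : Type*} {q : ℕ} (S : ℕ → Ω → Fin q → ℝ) {k m : ℕ}
    (hk : k < m) (ω : Ω) (i : Fin q) :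
    |increment S (k + 1) ω i| ≤ maxIncrement S m ω := by
  rw [← Real.norm_eq_abs]
  refine (norm_le_pi_norm (increment S (k + 1) ω) i).trans ?_
  have := Finset.le_sup (f := fun k => ‖increment S k ω‖₊)
    (Finset.mem_Icc.2 ⟨Nat.le_add_left 1 k, hk⟩)
  exact_mod_cast this

lemma measurable_increment {Ω : Type*} {mΩ : MeasurableSpace Ω} (ℱ : Filtration ℕ mΩ) {q : ℕ}
    {S : ℕ → Ω → Fin q → ℝ} {k m : ℕ} (hS : ∀ k ≤ m, Measurable[ℱ k] (S k)) (hk : k < m)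
    (i : Fin q) : Measurable[ℱ (k + 1)] fun ω => increment S (k + 1) ω i := by
  have h1 : Measurable[ℱ (k + 1)] (S (k + 1)) := hS _ hk
  have h2 : Measurable[ℱ (k + 1)] (S k) := (hS k hk.le).mono (ℱ.mono k.le_succ) le_rfl
  exact ((measurable_pi_apply i).comp h1).sub ((measurable_pi_apply i).comp h2)

lemma integrable_of_norm_le_of_lintegral_sq_le {Ω E F : Type*} {mΩ : MeasurableSpace Ω}
    [NormedAddCommGroup E] [NormedAddCommGroup F] {P : Measure Ω} [IsFiniteMeasure P] {X : Ω → E}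
    {Z : Ω → F} {C : ℝ≥0} (hX : AEStronglyMeasurable X P) (hXZ : ∀ ω, ‖X ω‖ ≤ ‖Z ω‖)
    (hZ : ∫⁻ ω, ‖Z ω‖ₑ ^ 2 ∂P ≤ C) : Integrable X P := by
  refine ⟨hX, ?_⟩
  rw [hasFiniteIntegral_iff_enorm]
  have hpt : ∀ ω, ‖X ω‖ₑ ≤ 1 + ‖Z ω‖ₑ ^ 2 := fun ω => by
    rw [enorm_eq_nnnorm, enorm_eq_nnnorm]
    norm_cast
    rw [← NNReal.coe_le_coe]
    push_cast
    nlinarith [hXZ ω, sq_nonneg (‖Z ω‖ - 1)]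
  refine (lintegral_mono hpt).trans_lt ?_
  rw [lintegral_add_left measurable_const, lintegral_const, one_mul]
  exact ENNReal.add_lt_top.2 ⟨measure_lt_top P _, hZ.trans_lt ENNReal.coe_lt_top⟩

section CoordinateSums

variable {q : ℕ} (t : Fin q → ℝ)

lemma abs_sum_mul_le {a : Fin q → ℝ} {b : ℝ} (h : ∀ i, |a i| ≤ b) :
    |∑ i, t i * a i| ≤ (∑ i, |t i|) * b := by
  rw [Finset.sum_mul]
  refine (Finset.abs_sum_le_sum_abs _ _).trans (Finset.sum_le_sum fun i _ => ?_)
  rw [abs_mul]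
  exact mul_le_mul_of_nonneg_left (h i) (abs_nonneg _)

lemma sum_sq_sum_mul_eq {ι : Type*} (s : Finset ι) (a : ι → Fin q → ℝ) :
    ∑ k ∈ s, (∑ i, t i * a k i) ^ 2 =
      ∑ p : Fin q × Fin q, t p.1 * t p.2 * ∑ k ∈ s, a k p.1 * a k p.2 := by
  simp only [Finset.mul_sum]
  rw [Finset.sum_comm]
  refine Finset.sum_congr rfl fun k _ => ?_
  rw [sq, Finset.sum_mul_sum, Fintype.sum_prod_type]
  exact Finset.sum_congr rfl fun i _ => Finset.sum_congr rfl fun j _ => by ring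

lemma dotProduct_mulVec_eq_sum_prod (A : Matrix (Fin q) (Fin q) ℝ) :
    t ⬝ᵥ A.mulVec t = ∑ p : Fin q × Fin q, t p.1 * t p.2 * A p.1 p.2 := by
  simp only [dotProduct, Matrix.mulVec, Finset.mul_sum]
  rw [Fintype.sum_prod_type]
  exact Finset.sum_congr rfl fun i _ => Finset.sum_congr rfl fun j _ => by ring

/-- The sum of squares is a continuous function of the finitely many entrywise sums. It serves both
the increments (`A = σ`) and their conditional means (`A = 0`). -/
lemma tendstoInProbability_sum_sq {Ω : ℕ → Type*} [∀ n, MeasurableSpace (Ω n)]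
    {P : ∀ n, Measure (Ω n)} {m : ℕ → ℕ} {a : ∀ n, ℕ → Ω n → Fin q → ℝ}
    {A : Matrix (Fin q) (Fin q) ℝ}
    (h : ∀ i j, TendstoInProbability P
      (fun n ω => ∑ k ∈ Finset.Icc 1 (m n), a n k ω i * a n k ω j) (A i j)) :
    TendstoInProbability P
      (fun n ω => ∑ k ∈ Finset.range (m n), (∑ i, t i * a n (k + 1) ω i) ^ 2)
      (t ⬝ᵥ A.mulVec t) := by
  have h1 : TendstoInProbability P (fun n ω (p : Fin q × Fin q) =>
      ∑ k ∈ Finset.range (m n), a n (k + 1) ω p.1 * a n (k + 1) ω p.2) fun p => A p.1 p.2 :=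
    .pi fun p => by
      have := h p.1 p.2
      simp only [sum_Icc_one_eq_sum_range] at this
      exact this
  have hf : Continuous fun B : Fin q × Fin q → ℝ => ∑ p, t p.1 * t p.2 * B p := by fun_prop
  have h2 := h1.comp_continuousAt hf.continuousAt
  simp only [← sum_sq_sum_mul_eq, ← dotProduct_mulVec_eq_sum_prod] at h2
  exact h2

end CoordinateSums

end NearMartingale

/-! ### Reduction to dimension one and conclusion -/

open NearMartingale in
theorem theorem3 {q : ℕ} {Ω : ℕ → Type*} [mΩ : ∀ n, MeasurableSpace (Ω n)]
    (P : ∀ n, Measure (Ω n)) [∀ n, IsProbabilityMeasure (P n)]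
    (m : ℕ → ℕ) (ℱ : ∀ n, Filtration ℕ (mΩ n))
    (S : ∀ n, ℕ → Ω n → Fin q → ℝ)
    (hS_adapted : ∀ n k, k ≤ m n → Measurable[ℱ n k] (S n k))
    (hS_zero : ∀ n, S n 0 =ᵐ[P n] 0)
    (σ : Matrix (Fin q) (Fin q) ℝ)
    (h_i : ∃ C : ℝ≥0, ∀ n,
      ∫⁻ ω, (NearMartingale.maxIncrement (S n) (m n) ω : ℝ≥0∞) ^ 2 ∂(P n) ≤ C)
    (h_ii : NearMartingale.TendstoInProbability P
      (fun n ω => NearMartingale.maxIncrement (S n) (m n) ω) 0)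
    (h_iii : ∀ i j : Fin q, NearMartingale.TendstoInProbability P
      (fun n ω => ∑ k ∈ Finset.Icc 1 (m n),
        NearMartingale.increment (S n) k ω i * NearMartingale.increment (S n) k ω j) (σ i j))
    (h_iv : NearMartingale.TendstoInProbability P
      (fun n ω => ∑ k ∈ Finset.Icc 1 (m n),
        NearMartingale.condIncrement (P n) (ℱ n) (S n) k ω) 0)
    (h_v : ∀ i j : Fin q, NearMartingale.TendstoInProbability P
      (fun n ω => ∑ k ∈ Finset.Icc 1 (m n),
        NearMartingale.condIncrement (P n) (ℱ n) (S n) k ω i *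
          NearMartingale.condIncrement (P n) (ℱ n) (S n) k ω j) 0) :
    σ.PosSemidef ∧
      TendstoInDistribution (fun n ω => WithLp.toLp 2 (S n (m n) ω)) atTop
        (id : EuclideanSpace ℝ (Fin q) → EuclideanSpace ℝ (Fin q)) P
        (multivariateGaussian 0 σ) := by
  obtain ⟨C, hC⟩ := h_i
  have hpsd : σ.PosSemidef := by
    refine Matrix.PosSemidef.of_dotProduct_mulVec_nonneg ?_ fun t => ?_
    · ext i j
      refine dist_eq_zero.1 ((h_iii j i).dist_eq_zero (P := P) ?_)
      simpa only [mul_comm] using h_iii i j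
    · exact (tendstoInProbability_sum_sq t h_iii).nonneg fun n ω =>
        Finset.sum_nonneg fun k _ => sq_nonneg _
  have hSm : ∀ n, Measurable (S n (m n)) := fun n =>
    (hS_adapted n (m n) le_rfl).mono ((ℱ n).le _) le_rfl
  have hmeas : ∀ n, Measurable fun ω => WithLp.toLp 2 (S n (m n) ω) := fun n =>
    (WithLp.measurable_toLp 2 _).comp (hSm n)
  refine ⟨hpsd, fun n => (hmeas n).aemeasurable, aemeasurable_id, ?_⟩
  refine ProbabilityMeasure.tendsto_iff_tendsto_charFun.2 fun t => ?_
  simp only [ProbabilityMeasure.coe_mk, Measure.map_id]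
  rw [charFun_multivariateGaussian hpsd]
  have hinc : ∀ n, ∀ k < m n, ∀ i, Measurable[ℱ n (k + 1)] fun ω => increment (S n) (k + 1) ω i :=
    fun n k hk i => measurable_increment (ℱ n) (hS_adapted n) hk i
  have hincm : ∀ n, ∀ k < m n, ∀ i, Measurable fun ω => increment (S n) (k + 1) ω i :=
    fun n k hk i => (hinc n k hk i).mono ((ℱ n).le _) le_rfl
  have hinci : ∀ n, ∀ k < m n, ∀ i, Integrable (fun ω => increment (S n) (k + 1) ω i) (P n) :=
    fun n k hk i => integrable_of_norm_le_of_lintegral_sq_le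
      (Z := fun ω => (maxIncrement (S n) (m n) ω : ℝ)) (C := C)
      (hincm n k hk i).aestronglyMeasurable
      (fun ω => (abs_increment_le_maxIncrement (S n) hk ω i).trans (le_abs_self _))
      (by simpa only [Real.enorm_eq_ofReal NNReal.zero_le_coe, ENNReal.ofReal_coe_nnreal] using hC n)
  -- The ℓ¹ norm of `t` is dual to the maximum norm, so `L` times the largest increment dominates
  -- every projected increment.
  set L : ℝ≥0 := ⟨∑ i, |t i|, Finset.sum_nonneg fun i _ => abs_nonneg _⟩ with hL
  have key := tendsto_integral_exp_I_mul_sum (P := P) (m := m) ℱ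
    (X := fun n k ω => ∑ i, t i * increment (S n) (k + 1) ω i)
    (Y := fun n k ω => ∑ i, t i * condIncrement (P n) (ℱ n) (S n) (k + 1) ω i)
    (Z := fun n ω => L * (maxIncrement (S n) (m n) ω : ℝ))
    (c := t.ofLp ⬝ᵥ σ.mulVec t.ofLp) (C := L ^ 2 * C)
    (fun n k hk => Finset.measurable_fun_sum _ fun i _ => (hinc n k hk i).const_mul _)
    (fun n k hk => Finset.measurable_fun_sum _ fun i _ =>
      (stronglyMeasurable_condExp.measurable).const_mul _)
    (fun n k hk => integrable_finsetSum _ fun i _ => (hinci n k hk i).const_mul _)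
    (fun n k hk => ?_)
    (fun n k hk ω => abs_sum_mul_le t.ofLp fun i => abs_increment_le_maxIncrement (S n) hk ω i)
    (fun n => ?_) ?_ (tendstoInProbability_sum_sq t.ofLp h_iii) ?_ ?_
  · have hlim : Complex.exp (((inner ℝ t (0 : EuclideanSpace ℝ (Fin q)) : ℝ) : ℂ) * Complex.I -
        ((t.ofLp ⬝ᵥ σ.mulVec t.ofLp : ℝ) : ℂ) / 2) =
        (Real.exp (-(t.ofLp ⬝ᵥ σ.mulVec t.ofLp) / 2) : ℂ) := by
      rw [inner_zero_right, Complex.ofReal_exp]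
      congr 1
      push_cast
      ring
    rw [hlim]
    refine key.congr fun n => ?_
    rw [charFun_apply, integral_map (hmeas n).aemeasurable (by fun_prop)]
    refine integral_congr_ae ?_
    -- The increments telescope to the final value only where the initial value vanishes.
    filter_upwards [hS_zero n] with ω hω
    have htel : ∑ k ∈ Finset.range (m n), ∑ i, t i * increment (S n) (k + 1) ω i =
        inner ℝ (WithLp.toLp 2 (S n (m n) ω)) t := by
      rw [Finset.sum_comm]
      simp only [PiLp.inner_apply, ← Finset.mul_sum]
      refine Finset.sum_congr rfl fun i _ => ?_
      have : ∑ k ∈ Finset.range (m n), increment (S n) (k + 1) ω i = S n (m n) ω i := by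
        have h := Finset.sum_range_sub (fun k => S n k ω i) (m n)
        rw [hω] at h
        simpa [increment] using h
      rw [this]
      simp
    rw [htel, mul_comm Complex.I]
  · refine EventuallyEq.symm ?_
    have hsum : (fun ω => ∑ i, t i * increment (S n) (k + 1) ω i) =
        ∑ i, t i • fun ω => increment (S n) (k + 1) ω i := by
      ext ω
      simp
    rw [hsum]
    refine (condExp_finsetSum (fun i _ => (hinci n k hk i).smul _) _).trans ?_
    have h1 : ∀ i, (P n)[t i • fun ω => increment (S n) (k + 1) ω i | ℱ n k] =ᵐ[P n]
        t i • (P n)[fun ω => increment (S n) (k + 1) ω i | ℱ n k] := fun i =>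
      condExp_smul _ _ _
    filter_upwards [ae_all_iff.2 h1] with ω hω
    simp only [Finset.sum_apply, hω]
    rfl
  · have e : ∀ ω, ‖(L : ℝ) * (maxIncrement (S n) (m n) ω : ℝ)‖ₑ ^ 2 =
        (L : ℝ≥0∞) ^ 2 * (maxIncrement (S n) (m n) ω : ℝ≥0∞) ^ 2 := fun ω => by
      rw [← NNReal.coe_mul, Real.enorm_eq_ofReal NNReal.zero_le_coe, ENNReal.ofReal_coe_nnreal,
        ENNReal.coe_mul, mul_pow]
    simp only [e]
    rw [lintegral_const_mul' _ _ (by simp)]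
    push_cast
    gcongr
    exact hC n
  · have hf : Continuous fun z : ℝ≥0 => (L : ℝ) * (z : ℝ) := by fun_prop
    simpa using h_ii.comp_continuousAt hf.continuousAt
  · have hf : Continuous fun z : Fin q → ℝ => ∑ i, t i * z i := by fun_prop
    have h := h_iv.comp_continuousAt hf.continuousAt
    simp only [Pi.zero_apply, mul_zero, Finset.sum_const_zero] at h
    convert h using 3 with n ω
    rw [sum_Icc_one_eq_sum_range]
    simp only [Finset.sum_apply, Finset.mul_sum]
    exact Finset.sum_comm
  · have h := tendstoInProbability_sum_sq t.ofLp (A := 0) h_v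
    simpa using h
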